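/- Let $[n]=\{1,\dots,n\}$, let $q\ge 3$ be odd, and let $\mathcal H_1,\dots,\mathcal H_k$ be $q$-uniform matchings on $[n]$ (families of pairwise disjoint $q$-element subsets). Let $\mathcal H=\bigcup_{i\in[k]}\mathcal H_i$ be their union as a multi-hypergraph (a set lying in several $\mathcal H_i$ gives that many parallel hyperedges, and hyperedges are counted with multiplicity). For $1\le r\le q$ let $d_r$ be the maximum, over $r$-element sets $Q\subseteq[n]$, of the number of hyperedges of $\mathcal H$ containing $Q$. Let $1\le t\le q$ and suppose that $\mathcal H$ is $t$-approximately strongly regular with partition $\mathcal H=\mathcal H_1^{(t)}\sqcup\dots\sqcup\mathcal H_{p}^{(t)}$ and sets $Q_1,\dots,Q_p\in\binom{[n]}{t}$, that is: 1. all $C\in\mathcal H^{(t)}_\theta$ contain $Q_\theta$, for every $\theta\in[p]$; 2. $d_t/2\le|\mathcal H^{(t)}_\theta|\le d_t$ for every $\theta\in[p]$; 3. $t$ is a good index for $d_1\ge\dots\ge d_q$, meaning (a) $d_r\le n^{1-2r/q}\,d_t$ for all $1\le r\le\lceil\frac{q-t}{2}\rceil$; (b) $d_r\le n^{-\frac2q(r-t)+\frac1q(t-\mathbf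 1(t\text{ even}))}\,d_t$ for all $t\le r\le\lfloor\frac{q+t}{2}\rfloor$; (c) if $t<q/2$ then $d_t\ge d_1n^{-2(t-1)/q}$, and if $t>q/2$ then $d_t\ge d_1n^{-1+2/q}$. Let the integer $\ell$ be $n^{1-2/q}\log n$ rounded up or down, and suppose that $k\ge d_1\ge\ell$. The level-$\ell$ Kikuchi graph has vertex set $\binom{[n]\times[2]}{\ell}$. For distinct hyperedges $C,C'\in\mathcal H^{(t)}_\theta$ put $X=(C\setminus Q_\theta)\times\{1\}$ and $Y=(C'\setminus Q_\theta)\times\{2\}$, and write $S\overset{C,C'}{\longleftrightarrow}T$ if the symmetric differences satisfy $S\oplus T=X\oplus Y$ and either $|S\cap X|=|T\cap Y|=\lceil\frac{q-t}2\rceil$ and $|S\cap Y|=|T\cap X|=\lfloor\frac{q-t}2\rfloor$, or the same holds with $\lceil\cdot\rceil$ and $\lfloor\cdot\rfloor$ exchanged. Let $\overline K^{(C,C')}$ be the $0/1$ matrix of this relation. For a partition $L\sqcup R=[k]$, signs $b\in\{\pm1\}^k$ and $i\in L$ let $$K_{i,t}=\sum_{j\in R}b_j\sum_{\theta\in[p]}\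 \sum_{C\in\mathcal H_i\cap\mathcal H^{(t)}_\theta,\ C'\in\mathcal H_j\cap\mathcal H^{(t)}_\theta}\overline K^{(C,C')},$$ and let $\deg_{K_{i,t}}(S)$ be the maximum over $b$ of the $\ell_1$ norm of row $S$ of $K_{i,t}$. Then $d_t\ge d_1n^{-2(t-1)/q}$ if $t<q/2$, and $d_t\ge d_1n^{-1+2/q}$ if $t>q/2$. Moreover, there is an absolute constant $W\ge1$ (independent of all the data above, including $q$) such that, for every partition $L\sqcup R=[k]$ and every $i\in L$, all but an $n^{-100q}$ fraction of the vertices $S\in\binom{[n]\times[2]}{\ell}$ satisfy $$\deg_{K_{i,t}}(S)\le\left(\frac{\ell}{n}\right)^{q-t}n\,d_t\,W^q .$$ -/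

import Mathlib

/-- A finite family `M` of subsets of `[n]` is a `q`-uniform (hypergraph) matching: every member
has exactly `q` elements, and distinct members are disjoint. -/
def IsUniformMatching {n : ℕ} (q : ℕ) (M : Finset (Finset (Fin n))) : Prop :=
  (∀ C ∈ M, C.card = q) ∧ ∀ C ∈ M, ∀ C' ∈ M, C ≠ C' → Disjoint C C'

/-- Hyperedges of the union `H = H_1 ∪ ⋯ ∪ H_k`, which is a multi-hypergraph: a set that lies in
several of the `H i` gives parallel hyperedges, one for each such `i`. -/
abbrev UnionEdge {n k : ℕ} (H : Fin k → Finset (Finset (Fin n))) : Type :=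
  (i : Fin k) × {C : Finset (Fin n) // C ∈ H i}

/-- The set of vertices of a hyperedge of the union. -/
def unionSupp {n k : ℕ} (H : Fin k → Finset (Finset (Fin n))) (e : UnionEdge H) :
    Finset (Fin n) :=
  e.2.1

/-- The co-degree of `Q` in the multi-hypergraph on `[n]` with hyperedges `supp e`, `e : E`:
the number of hyperedges (with multiplicity) that contain `Q`. -/
def codegree {n : ℕ} {E : Type} [Fintype E] (supp : E → Finset (Fin n)) (Q : Finset (Fin n)) : ℕ :=
  (Finset.univ.filter fun e : E => Q ⊆ supp e).card

/-- `d_r`: the maximum co-degree of a set of `r` vertices. -/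
def maxCodegree {n : ℕ} {E : Type} [Fintype E] (supp : E → Finset (Fin n)) (r : ℕ) : ℕ :=
  (Finset.powersetCard r Finset.univ).sup (codegree supp)

/-- `t` is a good index for the sequence `d_1 ≥ ⋯ ≥ d_q` (on a ground set of size `n`). The bounds
on the quotients `d_r / d_t` are written without division. For `t ≤ q` the natural number
`(q - t + 1) / 2` is `⌈(q - t) / 2⌉` and `(q + t) / 2` is `⌊(q + t) / 2⌋`. -/
structure IsGoodIndex (n q t : ℕ) (d : ℕ → ℕ) : Prop where
  small : ∀ r : ℕ, 1 ≤ r → r ≤ (q - t + 1) / 2 →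
    (d r : ℝ) ≤ (n : ℝ) ^ (1 - 2 * (r : ℝ) / q) * d t
  large : ∀ r : ℕ, t ≤ r → r ≤ (q + t) / 2 →
    (d r : ℝ) ≤ (n : ℝ) ^ (-(2 / (q : ℝ)) * ((r : ℝ) - t)
      + 1 / (q : ℝ) * ((t : ℝ) - if Even t then 1 else 0)) * d t
  lower_left : 2 * t < q → (d 1 : ℝ) * (n : ℝ) ^ (-(2 / (q : ℝ)) * ((t : ℝ) - 1)) ≤ d t
  lower_right : q < 2 * t → (d 1 : ℝ) * (n : ℝ) ^ (-1 + 2 / (q : ℝ)) ≤ d t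

/-- The map `part : E → Fin p`, together with the sets `Q θ`, is a partition of the hyperedges that
witnesses the `t`-approximate strong regularity of a `q`-uniform multi-hypergraph. The piece
`H_θ` consists of the hyperedges `e` with `part e = θ`. -/
structure IsStrongRegularPartition {n : ℕ} {E : Type} [Fintype E] (q t : ℕ)
    (supp : E → Finset (Fin n)) {p : ℕ} (part : E → Fin p) (Q : Fin p → Finset (Fin n)) :
    Prop where
  uniform : ∀ e, (supp e).card = q
  one_le : 1 ≤ t
  le : t ≤ q
  card_Q : ∀ θ, (Q θ).card = t
  subset : ∀ e, Q (part e) ⊆ supp e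
  half_le : ∀ θ, (maxCodegree supp t : ℝ) / 2 ≤ (Finset.univ.filter fun e => part e = θ).card
  card_le : ∀ θ, (Finset.univ.filter fun e => part e = θ).card ≤ maxCodegree supp t
  good : IsGoodIndex n q t (maxCodegree supp)

/-- Vertices of the level-`ℓ` Kikuchi graph: the `ℓ`-element subsets of `[n] × [2]`. -/
abbrev KikuchiVertex (n ℓ : ℕ) : Type := {S : Finset (Fin n × Fin 2) // S.card = ℓ}

/-- The relation `S ↔ T` induced by `A = C \ Q_θ` and `A' = C' \ Q_θ`, with `m = q - t`. Here
`X = A × {1}` and `Y = A' × {2}` (the two copies are numbered `0` and `1`). -/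
def KikuchiAdj {n : ℕ} (m : ℕ) (A A' : Finset (Fin n)) (S T : Finset (Fin n × Fin 2)) : Prop :=
  let X : Finset (Fin n × Fin 2) := A ×ˢ {0}
  let Y : Finset (Fin n × Fin 2) := A' ×ˢ {1}
  symmDiff S T = symmDiff X Y ∧
  (Even m → (S ∩ X).card = m / 2 ∧ (S ∩ Y).card = m / 2 ∧
    (T ∩ X).card = m / 2 ∧ (T ∩ Y).card = m / 2) ∧
  (Odd m →
    ((S ∩ X).card = (m + 1) / 2 ∧ (T ∩ Y).card = (m + 1) / 2 ∧
      (S ∩ Y).card = m / 2 ∧ (T ∩ X).card = m / 2) ∨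
    ((S ∩ X).card = m / 2 ∧ (T ∩ Y).card = m / 2 ∧
      (S ∩ Y).card = (m + 1) / 2 ∧ (T ∩ X).card = (m + 1) / 2))

open Classical in
/-- The 0/1 matrix of the relation induced by one pair of hyperedges. -/
noncomputable def kikuchiPairMatrix {n : ℕ} (m ℓ : ℕ) (A A' : Finset (Fin n)) :
    Matrix (KikuchiVertex n ℓ) (KikuchiVertex n ℓ) ℝ :=
  fun S T => if KikuchiAdj m A A' S.1 T.1 then 1 else 0

/-- The unsigned Kikuchi matrix of the pair of matchings `H i`, `H j`, with `m = q - t`: the sum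
over `θ` and over `C ∈ H_i ∩ H_θ`, `C' ∈ H_j ∩ H_θ` of the matrices of the pairs `(C, C')`. -/
noncomputable def kikuchiUnsigned {n k p : ℕ} (m ℓ : ℕ) (H : Fin k → Finset (Finset (Fin n)))
    (part : UnionEdge H → Fin p) (Q : Fin p → Finset (Fin n)) (i j : Fin k) :
    Matrix (KikuchiVertex n ℓ) (KikuchiVertex n ℓ) ℝ :=
  ∑ θ : Fin p,
    ∑ e ∈ Finset.univ.filter (fun e : UnionEdge H => e.1 = i ∧ part e = θ),
      ∑ e' ∈ Finset.univ.filter (fun e' : UnionEdge H => e'.1 = j ∧ part e' = θ),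
        kikuchiPairMatrix m ℓ (unionSupp H e \ Q θ) (unionSupp H e' \ Q θ)

/-- The signed Kikuchi matrix `K_i = ∑_{j ∈ R} b_j K̄_{i,j}` for signs `b : [k] → {1, -1}`. -/
noncomputable def kikuchiSigned {n k p : ℕ} (m ℓ : ℕ) (H : Fin k → Finset (Finset (Fin n)))
    (part : UnionEdge H → Fin p) (Q : Fin p → Finset (Fin n)) (R : Finset (Fin k))
    (b : Fin k → ℤˣ) (i : Fin k) : Matrix (KikuchiVertex n ℓ) (KikuchiVertex n ℓ) ℝ :=
  ∑ j ∈ R, (((b j : ℤˣ) : ℤ) : ℝ) • kikuchiUnsigned m ℓ H part Q i j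

/-- The degree of `S` in `K_i`: the maximum, over all choices of signs, of the `ℓ₁` norm of the row
of the signed matrix indexed by `S`. -/
noncomputable def kikuchiDegree {n k p : ℕ} (m ℓ : ℕ) (H : Fin k → Finset (Finset (Fin n)))
    (part : UnionEdge H → Fin p) (Q : Fin p → Finset (Fin n)) (R : Finset (Fin k))
    (i : Fin k) (S : KikuchiVertex n ℓ) : ℝ :=
  ⨆ b : Fin k → ℤˣ, ∑ T : KikuchiVertex n ℓ, |kikuchiSigned m ℓ H part Q R b i S T|

/-!
The degree of `S` is at most the number of triples of a linked pair `(C, C')` and a balanced half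
of `(C \ Q_θ) × {1} ∪ (C' \ Q_θ) × {2}` that is contained in `S`. Each half is a set of `m = q - t`
elements, and the matching property of `H_i` together with the goodness of `t` implies that the
halves form a spread family: at most `c u ^ |A|` of them contain a given set `A`, where
`c = 4 ^ m n d_t` and `u = n ^ (-2 / q)`.

A random `ℓ`-set contains a given set `U` with probability at most `(ℓ / n) ^ |U|`. Expanding the
`s`-th moment of the number of halves inside `S` and adding one half `D` after the other to `U`,
spreadness gives `∑_D p ^ |D \ U| ≤ c p ^ m (1 + u / p) ^ |U|` with `p = ℓ / n`. Since `|U| ≤ s m`,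
and `s u / p = O(1)` for `s = ⌈log n⌉` and `ℓ ≈ n ^ (1 - 2 / q) log n`, every factor of the moment
costs `c p ^ m e ^ O(m)`, and Markov's inequality for the `s`-th moment yields the tail
`e ^ (-100 q s) ≤ n ^ (-100 q)`.
-/

open Finset

theorem descFactorial_mul_pow_le {ℓ N : ℕ} (h : ℓ ≤ N) (a : ℕ) :
    ℓ.descFactorial a * N ^ a ≤ ℓ ^ a * N.descFactorial a := by
  induction a with
  | zero => simp
  | succ a ih =>
    have factor_le : (ℓ - a) * N ≤ ℓ * (N - a) := by
      rw [Nat.sub_mul, Nat.mul_sub, Nat.mul_comm ℓ a]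
      exact Nat.sub_le_sub_left (Nat.mul_le_mul_left a h) _
    calc ℓ.descFactorial (a + 1) * N ^ (a + 1)
        = (ℓ - a) * N * (ℓ.descFactorial a * N ^ a) := by rw [Nat.descFactorial_succ]; ring
      _ ≤ ℓ * (N - a) * (ℓ ^ a * N.descFactorial a) := Nat.mul_le_mul factor_le ih
      _ = ℓ ^ (a + 1) * N.descFactorial (a + 1) := by rw [Nat.descFactorial_succ]; ring

theorem choose_sub_mul_pow_le {a ℓ N : ℕ} (ha : a ≤ ℓ) (h : ℓ ≤ N) :
    (N - a).choose (ℓ - a) * N ^ a ≤ ℓ ^ a * N.choose ℓ := by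
  refine Nat.le_of_mul_le_mul_left ?_ (Nat.descFactorial_pos.2 (ha.trans h))
  calc N.descFactorial a * ((N - a).choose (ℓ - a) * N ^ a)
      = ℓ.descFactorial a * N ^ a * N.choose ℓ := by
        rw [Nat.descFactorial_eq_factorial_mul_choose, Nat.descFactorial_eq_factorial_mul_choose]
        linear_combination (a.factorial * N ^ a) * (Nat.choose_mul (n := N) ha).symm
    _ ≤ ℓ ^ a * N.descFactorial a * N.choose ℓ :=
        Nat.mul_le_mul_right _ (descFactorial_mul_pow_le h a)
    _ = N.descFactorial a * (ℓ ^ a * N.choose ℓ) := by ring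

theorem card_filter_subset_le_mul_pow {α : Type*} [Fintype α] [DecidableEq α] (ℓ : ℕ)
    (U : Finset α) :
    (#{S : {S : Finset α // #S = ℓ} | U ⊆ S.1} : ℝ)
      ≤ Fintype.card {S : Finset α // #S = ℓ} * ((ℓ : ℝ) / Fintype.card α) ^ #U := by
  rcases Finset.eq_empty_or_nonempty {S : {S : Finset α // #S = ℓ} | U ⊆ S.1} with h | ⟨S, hS⟩
  · rw [h, card_empty, Nat.cast_zero]
    positivity
  have hU : #U ≤ ℓ := S.2 ▸ card_le_card (mem_filter.1 hS).2
  have hℓ : ℓ ≤ Fintype.card α := S.2 ▸ card_le_univ S.1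
  have hpos : 0 < Fintype.card α ^ #U := by
    rcases U.eq_empty_or_nonempty with rfl | ⟨x, -⟩
    · simp
    · exact pow_pos (Fintype.card_pos_iff.2 ⟨x⟩) _
  have hcard : #{S : {S : Finset α // #S = ℓ} | U ⊆ S.1}
      = (Fintype.card α - #U).choose (ℓ - #U) := by
    rw [← card_univ, ← card_filter_powersetCard_subset U univ ℓ (subset_univ U) hU,
      ← card_map (Function.Embedding.subtype _)]
    congr 1
    ext S
    simp [and_comm]
  rw [hcard, Fintype.card_finset_len, div_pow, ← mul_div_assoc,
    le_div_iff₀ (by exact_mod_cast hpos), mul_comm ((Nat.choose _ ℓ : ℕ) : ℝ)]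
  exact_mod_cast choose_sub_mul_pow_le hU hℓ

section Spread

variable {ι α : Type*} [DecidableEq α] {I : Finset ι} {M : ι → Finset α} {c u : ℝ} {m : ℕ}

/-- The family `M i`, `i ∈ I`, of finite sets is spread with parameters `c` and `u`: every finite
set `A` lies in at most `c * u ^ #A` of its members, counted with multiplicity. With `c = #I` and
`u = 1 / κ` this is the notion of a `κ`-spread family in the literature on sunflowers and
thresholds. -/
def IsSpread (I : Finset ι) (M : ι → Finset α) (c u : ℝ) : Prop :=
  ∀ A : Finset α, (#{i ∈ I | A ⊆ M i} : ℝ) ≤ c * u ^ #A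

theorem IsSpread.card_filter_subset_le (h : IsSpread I M c u) (S : Finset α) :
    (#{i ∈ I | M i ⊆ S} : ℝ) ≤ c :=
  calc (#{i ∈ I | M i ⊆ S} : ℝ) ≤ #{i ∈ I | ∅ ⊆ M i} := by
        exact_mod_cast card_le_card (monotone_filter_right I fun i _ _ => empty_subset (M i))
    _ ≤ c := by simpa only [card_empty, pow_zero, mul_one] using h ∅

theorem IsSpread.card_filter_subset_empty_le (h : IsSpread I M c u) (hM : ∀ i ∈ I, #(M i) = m) :
    (#{i ∈ I | M i ⊆ ∅} : ℝ) ≤ c * 0 ^ m := by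
  rcases eq_or_ne m 0 with rfl | hm
  · simpa only [pow_zero, mul_one] using h.card_filter_subset_le ∅
  · rw [filter_eq_empty_iff.2 fun i hi hsub => ?_, card_empty, Nat.cast_zero, zero_pow hm, mul_zero]
    rw [← hM i hi, subset_empty.1 hsub] at hm
    exact hm card_empty

theorem IsSpread.sum_pow_card_sdiff_le (h : IsSpread I M c u) (hM : ∀ i ∈ I, #(M i) = m) {p : ℝ}
    (hp : 0 < p) (U : Finset α) :
    ∑ i ∈ I, p ^ #(M i \ U) ≤ c * p ^ m * (1 + u / p) ^ #U := by
  have term_le : ∀ i ∈ I, p ^ #(M i \ U) ≤ ∑ A ∈ U.powerset with A ⊆ M i, p ^ m * p⁻¹ ^ #A := by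
    intro i hi
    have hcard : m = #(M i \ U) + #(U ∩ M i) := by
      rw [← hM i hi, inter_comm, card_sdiff_add_card_inter]
    calc p ^ #(M i \ U) = p ^ m * p⁻¹ ^ #(U ∩ M i) := by
          rw [hcard, pow_add, mul_assoc, ← mul_pow, mul_inv_cancel₀ hp.ne', one_pow, mul_one]
      _ ≤ ∑ A ∈ U.powerset with A ⊆ M i, p ^ m * p⁻¹ ^ #A := by
          refine single_le_sum (f := fun A => p ^ m * p⁻¹ ^ #A) (fun A _ => by positivity) ?_
          exact mem_filter.2 ⟨mem_powerset.2 inter_subset_left, inter_subset_right⟩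
  calc ∑ i ∈ I, p ^ #(M i \ U)
      ≤ ∑ i ∈ I, ∑ A ∈ U.powerset with A ⊆ M i, p ^ m * p⁻¹ ^ #A := sum_le_sum term_le
    _ = ∑ A ∈ U.powerset, #{i ∈ I | A ⊆ M i} * (p ^ m * p⁻¹ ^ #A) := by
        simp only [sum_filter]
        rw [sum_comm]
        simp only [← sum_filter, sum_const, nsmul_eq_mul]
    _ ≤ ∑ A ∈ U.powerset, c * u ^ #A * (p ^ m * p⁻¹ ^ #A) := by
        gcongr with A
        exact h A
    _ = c * p ^ m * (1 + u / p) ^ #U := by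
        rw [add_comm, ← sum_pow_mul_eq_add_pow, mul_sum]
        refine sum_congr rfl fun A _ => ?_
        rw [one_pow, div_eq_mul_inv, mul_pow]
        ring

/-- Expanding one factor of the power turns the event `U ⊆ S` into `U ∪ M i ⊆ S`. -/
theorem IsSpread.sum_pow_card_filter_subset_le [Fintype α] (h : IsSpread I M c u)
    (hM : ∀ i ∈ I, #(M i) = m) (hc : 0 ≤ c) (hu : 0 ≤ u) {ℓ : ℕ} {p : ℝ} (hp : 0 < p)
    (hℓ : (ℓ : ℝ) / Fintype.card α ≤ p) {K : ℕ} (s : ℕ) (U : Finset α) (hU : #U + s * m ≤ K) :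
    ∑ S : {S : Finset α // #S = ℓ} with U ⊆ S.1, (#{i ∈ I | M i ⊆ S.1} : ℝ) ^ s
      ≤ Fintype.card {S : Finset α // #S = ℓ} * p ^ #U * (c * p ^ m * (1 + u / p) ^ K) ^ s := by
  induction s generalizing U with
  | zero =>
    simp only [pow_zero, sum_const, nsmul_eq_mul, mul_one]
    refine (card_filter_subset_le_mul_pow ℓ U).trans ?_
    gcongr
  | succ s ih =>
    set N : ℝ := (Fintype.card {S : Finset α // #S = ℓ} : ℝ)
    set B : ℝ := c * p ^ m * (1 + u / p) ^ K
    rw [Nat.succ_mul] at hU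
    calc ∑ S : {S : Finset α // #S = ℓ} with U ⊆ S.1, (#{i ∈ I | M i ⊆ S.1} : ℝ) ^ (s + 1)
        = ∑ i ∈ I, ∑ S : {S : Finset α // #S = ℓ} with U ∪ M i ⊆ S.1,
            (#{i ∈ I | M i ⊆ S.1} : ℝ) ^ s := by
          rw [sum_comm' (t' := {S | U ⊆ S.1}) (s' := fun S => {i ∈ I | M i ⊆ S.1})
            fun i S => by
              simp only [mem_filter, mem_univ, true_and, union_subset_iff]
              tauto]
          simp only [sum_const, nsmul_eq_mul, pow_succ']
      _ ≤ ∑ i ∈ I, N * p ^ #(U ∪ M i) * B ^ s := by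
          refine sum_le_sum fun i hi => ih (U ∪ M i) ?_
          have := card_union_le U (M i)
          rw [hM i hi] at this
          omega
      _ = N * p ^ #U * B ^ s * ∑ i ∈ I, p ^ #(M i \ U) := by
          rw [mul_sum]
          refine sum_congr rfl fun i _ => ?_
          rw [← union_sdiff_self_eq_union, card_union_of_disjoint disjoint_sdiff, pow_add]
          ring
      _ ≤ N * p ^ #U * B ^ s * B := by
          refine mul_le_mul_of_nonneg_left ?_ (by positivity)
          refine (h.sum_pow_card_sdiff_le hM hp U).trans
            (mul_le_mul_of_nonneg_left (pow_le_pow_right₀ ?_ (by omega)) (by positivity))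
          exact le_add_of_nonneg_right (by positivity)
      _ = N * p ^ #U * B ^ (s + 1) := by rw [pow_succ]; ring

theorem card_filter_lt_le_mul_exp {V : Type*} [Fintype V] {f : V → ℝ} (hf : ∀ S, 0 ≤ f S) {B : ℝ}
    (hB : 0 < B) {s : ℕ} (hs : ∑ S, f S ^ s ≤ Fintype.card V * B ^ s) (b : ℝ) :
    (#{S | B * Real.exp b < f S} : ℝ) ≤ Fintype.card V * Real.exp (-(b * s)) := by
  have markov : (#{S | B * Real.exp b < f S} : ℝ) * (B * Real.exp b) ^ s
      ≤ Fintype.card V * B ^ s := by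
    refine le_trans ?_ hs
    rw [← nsmul_eq_mul]
    refine (card_nsmul_le_sum _ (fun S => f S ^ s) _ fun S hS => ?_).trans
      (sum_le_univ_sum_of_nonneg fun S => pow_nonneg (hf S) s)
    exact pow_le_pow_left₀ (by positivity) (mem_filter.1 hS).2.le s
  refine le_of_mul_le_mul_right (markov.trans_eq ?_) (by positivity : 0 < (B * Real.exp b) ^ s)
  rw [mul_pow, ← Real.exp_nat_mul, Real.exp_neg, mul_comm b]
  field_simp

theorem IsSpread.card_filter_lt_le [Fintype α] (h : IsSpread I M c u)
    (hM : ∀ i ∈ I, #(M i) = m) (hc : 0 ≤ c) (hu : 0 ≤ u) {ℓ : ℕ} {p : ℝ} (hp : 0 < p)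
    (hℓ : (ℓ : ℝ) / Fintype.card α ≤ p) {s : ℕ} {a : ℝ} (hs : s * u ≤ a * p) (b : ℝ) :
    (#{S : {S : Finset α // #S = ℓ} |
        c * (p * Real.exp a) ^ m * Real.exp b < #{i ∈ I | M i ⊆ S.1}} : ℝ)
      ≤ Fintype.card {S : Finset α // #S = ℓ} * Real.exp (-(b * s)) := by
  rcases hc.eq_or_lt with rfl | hc
  · rw [filter_eq_empty_iff.2 fun S _ => ?_, card_empty, Nat.cast_zero]
    · positivity
    · simpa only [zero_mul] using (h.card_filter_subset_le S.1).not_gt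
  refine card_filter_lt_le_mul_exp (fun S => Nat.cast_nonneg _) (by positivity) ?_ b
  have moment := h.sum_pow_card_filter_subset_le hM hc.le hu hp hℓ s ∅ (K := s * m) (by simp)
  simp only [empty_subset, filter_true, card_empty, pow_zero, mul_one] at moment
  refine moment.trans ?_
  rw [mul_pow p, ← mul_assoc c]
  gcongr
  calc (1 + u / p) ^ (s * m) ≤ Real.exp (u / p) ^ (s * m) := by
        gcongr
        rw [add_comm]
        exact Real.add_one_le_exp _
    _ = Real.exp (s * (u / p)) ^ m := by rw [pow_mul, ← Real.exp_nat_mul]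
    _ ≤ Real.exp a ^ m := by
        gcongr
        rwa [← mul_div_assoc, div_le_iff₀ hp]

end Spread

section Codegree

variable {n : ℕ} {E : Type} [Fintype E] (supp : E → Finset (Fin n))

theorem codegree_le_maxCodegree (A : Finset (Fin n)) : codegree supp A ≤ maxCodegree supp #A :=
  le_sup (f := codegree supp) (mem_powersetCard.2 ⟨subset_univ _, rfl⟩)

theorem maxCodegree_antitone : Antitone (maxCodegree supp) := by
  refine fun r s hrs => Finset.sup_le fun A hA => ?_
  obtain ⟨B, hBA, rfl⟩ := exists_subset_card_eq (hrs.trans_eq (mem_powersetCard.1 hA).2.symm)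
  refine le_trans (card_le_card fun e he => ?_) (codegree_le_maxCodegree supp B)
  rw [mem_filter] at he ⊢
  exact ⟨he.1, hBA.trans he.2⟩

end Codegree

theorem IsGoodIndex.le_rpow {n q t : ℕ} {d : ℕ → ℕ} (h : IsGoodIndex n q t d) (hn : 1 ≤ n)
    (hq : Odd q) (ht : t ≤ q) {a a' : ℕ} (ha : a ≤ (q - t + 1) / 2) (haa' : a + a' ≤ q - t) :
    (d (min (t + a') ((q + t) / 2)) : ℝ) ≤ (n : ℝ) ^ (1 - 2 * ((a + a' : ℕ) : ℝ) / q) * d t := by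
  obtain ⟨r, hr⟩ : ∃ r, min (t + a') ((q + t) / 2) = r := ⟨_, rfl⟩
  rw [hr]
  have exponent_nat : 2 * (a + a') + 3 * t ≤ q + 2 * r + if Even t then 1 else 0 := by
    have hq' := Nat.odd_iff.1 hq
    split_ifs with ht' <;> rw [Nat.even_iff] at ht' <;> omega
  have exponent_real : 2 * ((a + a' : ℕ) : ℝ) + 3 * t ≤ q + 2 * r + if Even t then 1 else 0 := by
    exact_mod_cast exponent_nat
  refine (h.large r (by omega) (by omega)).trans ?_
  gcongr
  · exact_mod_cast hn
  have hq0 : (0 : ℝ) < q := by exact_mod_cast hq.pos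
  rw [← sub_nonneg]
  calc (0 : ℝ) ≤ (q + 2 * r + (if Even t then 1 else 0) - (2 * ((a + a' : ℕ) : ℝ) + 3 * t)) / q :=
        div_nonneg (sub_nonneg.2 exponent_real) hq0.le
    _ = _ := by
        field_simp
        ring

section LinkedPairs

variable {n p q t : ℕ} {E : Type} {supp : E → Finset (Fin n)} {part : E → Fin p}
  {Q : Fin p → Finset (Fin n)} {M : Finset E} {A A' : Finset (Fin n)}

/-- The set `C \ Q_θ` for the hyperedge `C = supp e` of the piece `H_θ`: the hyperedge of the link
of `Q_θ` that comes from `C`. -/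
def linkEdge (supp : E → Finset (Fin n)) (part : E → Fin p) (Q : Fin p → Finset (Fin n)) (e : E) :
    Finset (Fin n) :=
  supp e \ Q (part e)

variable [Fintype E]

/-- The pairs `(C, C')` of hyperedges in a common piece `H_θ` with `C ∈ M`. As in the definition of
the Kikuchi matrices, `C = C'` is allowed. -/
def linkedPairs (part : E → Fin p) (M : Finset E) : Finset (E × E) :=
  {x ∈ M ×ˢ univ | part x.1 = part x.2}

/-- The linked pairs `(C, C')` with `A ⊆ C \ Q_θ` and `A' ⊆ C' \ Q_θ`. -/
def linkedPairsAbove (supp : E → Finset (Fin n)) (part : E → Fin p) (Q : Fin p → Finset (Fin n))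
    (M : Finset E) (A A' : Finset (Fin n)) : Finset (E × E) :=
  {x ∈ linkedPairs part M | A ⊆ linkEdge supp part Q x.1 ∧ A' ⊆ linkEdge supp part Q x.2}

theorem mem_linkedPairs {x : E × E} : x ∈ linkedPairs part M ↔ x.1 ∈ M ∧ part x.1 = part x.2 := by
  simp [linkedPairs]

theorem mem_linkedPairsAbove {x : E × E} :
    x ∈ linkedPairsAbove supp part Q M A A' ↔ (x.1 ∈ M ∧ part x.1 = part x.2) ∧
      A ⊆ linkEdge supp part Q x.1 ∧ A' ⊆ linkEdge supp part Q x.2 := by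
  rw [linkedPairsAbove, mem_filter, mem_linkedPairs]

theorem card_linkEdge (hP : IsStrongRegularPartition q t supp part Q) (e : E) :
    #(linkEdge supp part Q e) = q - t := by
  rw [linkEdge, card_sdiff_of_subset (hP.subset e), hP.uniform, hP.card_Q]

theorem card_linkedPairs_le (hP : IsStrongRegularPartition q t supp part Q)
    (hM : (M : Set E).PairwiseDisjoint supp) : #(linkedPairs part M) ≤ n * maxCodegree supp t := by
  have hM_card : #M ≤ n := by
    refine (card_le_card_biUnion hM fun e _ => card_pos.1 ?_).trans (card_finset_fin_le _)
    rw [hP.uniform]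
    exact hP.one_le.trans hP.le
  calc #(linkedPairs part M) = ∑ e ∈ M, #{e' | part e' = part e} := by
        simp only [linkedPairs, card_filter, sum_product, eq_comm]
    _ ≤ #M * maxCodegree supp t := sum_le_card_nsmul _ _ _ fun e _ => hP.card_le (part e)
    _ ≤ n * maxCodegree supp t := Nat.mul_le_mul_right _ hM_card

/-- As `C ∈ M` contains the nonempty set `Q_θ`, it is determined by `C'`. -/
theorem card_linkedPairsAbove_le_maxCodegree (hP : IsStrongRegularPartition q t supp part Q)
    (hM : (M : Set E).PairwiseDisjoint supp) :
    #(linkedPairsAbove supp part Q M A A') ≤ maxCodegree supp #A' := by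
  refine (card_le_card_of_injOn Prod.snd (fun x hx => ?_) ?_).trans
    (codegree_le_maxCodegree supp A')
  · have hA' := (mem_linkedPairsAbove.1 hx).2.2
    simpa using hA'.trans sdiff_subset
  · rintro ⟨e, f⟩ hef ⟨e', -⟩ he'f rfl
    obtain ⟨⟨he, hθ⟩, -⟩ := mem_linkedPairsAbove.1 hef
    obtain ⟨⟨he', hθ'⟩, -⟩ := mem_linkedPairsAbove.1 he'f
    obtain ⟨x, hx⟩ : (Q (part f)).Nonempty := card_pos.1 (by rw [hP.card_Q]; exact hP.one_le)
    have : e = e' := hM.elim_finset he he' x (hP.subset e (hθ ▸ hx)) (hP.subset e' (hθ' ▸ hx))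
    rw [this]

/-- As `C ∈ M` contains `A ≠ ∅`, it does not depend on the pair, and `C'` contains `Q_θ ∪ A'`. -/
theorem card_linkedPairsAbove_le_maxCodegree_add (hP : IsStrongRegularPartition q t supp part Q)
    (hM : (M : Set E).PairwiseDisjoint supp) (hA : A.Nonempty) :
    #(linkedPairsAbove supp part Q M A A') ≤ maxCodegree supp (t + #A') := by
  rcases (linkedPairsAbove supp part Q M A A').eq_empty_or_nonempty with hempty | ⟨⟨e, e'⟩, hee'⟩
  · simp [hempty]
  obtain ⟨x, hx⟩ := hA
  obtain ⟨⟨he, hθ⟩, hAe, hAe'⟩ := mem_linkedPairsAbove.1 hee'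
  have fst_eq : ∀ y ∈ linkedPairsAbove supp part Q M A A', y.1 = e := fun y hy => by
    obtain ⟨⟨hyM, -⟩, hAy, -⟩ := mem_linkedPairsAbove.1 hy
    exact hM.elim_finset hyM he x (sdiff_subset (hAy hx)) (sdiff_subset (hAe hx))
  have hdisj : Disjoint (Q (part e)) A' := hθ ▸ disjoint_sdiff.mono_right hAe'
  rw [← hP.card_Q (part e), ← card_union_of_disjoint hdisj]
  refine (card_le_card_of_injOn Prod.snd (fun y hy => ?_) ?_).trans
    (codegree_le_maxCodegree supp _)
  · obtain ⟨⟨-, hyθ⟩, -, hAy'⟩ := mem_linkedPairsAbove.1 hy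
    rw [fst_eq y hy] at hyθ
    simpa using union_subset (hyθ ▸ hP.subset y.2) (hAy'.trans sdiff_subset)
  · exact fun y hy z hz h => Prod.ext ((fst_eq y hy).trans (fst_eq z hz).symm) h

theorem card_linkedPairsAbove_le_rpow (hq : Odd q) (hP : IsStrongRegularPartition q t supp part Q)
    (hM : (M : Set E).PairwiseDisjoint supp) (hA : #A ≤ (q - t + 1) / 2)
    (hA' : #A' ≤ (q - t + 1) / 2) (hAA' : #A + #A' ≤ q - t) :
    (#(linkedPairsAbove supp part Q M A A') : ℝ)
      ≤ n * maxCodegree supp t * ((n : ℝ) ^ (-(2 / (q : ℝ)))) ^ (#A + #A') := by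
  rcases (linkedPairsAbove supp part Q M A A').eq_empty_or_nonempty with hempty | ⟨⟨e, -⟩, -⟩
  · rw [hempty, card_empty, Nat.cast_zero]
    positivity
  have hn : 1 ≤ n := by
    have := card_finset_fin_le (supp e)
    rw [hP.uniform] at this
    exact hq.pos.trans_le this
  have rpow_eq : (n : ℝ) ^ (1 - 2 * ((#A + #A' : ℕ) : ℝ) / q)
      = n * ((n : ℝ) ^ (-(2 / (q : ℝ)))) ^ (#A + #A') := by
    rw [← Real.rpow_mul_natCast (Nat.cast_nonneg n), sub_eq_add_neg,
      Real.rpow_add (by exact_mod_cast hn), Real.rpow_one]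
    ring_nf
  rw [mul_right_comm, ← rpow_eq]
  rcases A.eq_empty_or_nonempty with rfl | hA_ne
  · rcases A'.eq_empty_or_nonempty with rfl | hA'_ne
    · rw [card_empty, add_zero, Nat.cast_zero, mul_zero, zero_div, sub_zero, Real.rpow_one]
      exact_mod_cast (card_filter_le _ _).trans (card_linkedPairs_le hP hM)
    · rw [card_empty, zero_add]
      exact (Nat.cast_le.2 (card_linkedPairsAbove_le_maxCodegree hP hM)).trans
        (hP.good.small #A' hA'_ne.card_pos hA')
  · refine le_trans ?_ (hP.good.le_rpow hn hq hP.le hA hAA')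
    exact_mod_cast (card_linkedPairsAbove_le_maxCodegree_add hP hM hA_ne).trans
      (maxCodegree_antitone supp (min_le_left _ _))

end LinkedPairs

section BalancedPairs

variable {n m : ℕ} {A A' D D' : Finset (Fin n)}

/-- The subset `A × {1} ∪ A' × {2}` of `[n] × [2]`, with the two copies numbered `0` and `1`. -/
def twoCopies (A A' : Finset (Fin n)) : Finset (Fin n × Fin 2) :=
  A ×ˢ {0} ∪ A' ×ˢ {1}

theorem card_twoCopies (A A' : Finset (Fin n)) : #(twoCopies A A') = #A + #A' := by
  rw [twoCopies, card_union_of_disjoint]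
  · simp only [card_product, card_singleton, mul_one]
  · exact disjoint_product.2 (Or.inr (by decide))

theorem twoCopies_subset_twoCopies : twoCopies A A' ⊆ twoCopies D D' ↔ A ⊆ D ∧ A' ⊆ D' := by
  simp [twoCopies, subset_iff, forall_and]

theorem exists_eq_twoCopies (B : Finset (Fin n × Fin 2)) : ∃ A A', B = twoCopies A A' := by
  refine ⟨univ.filter fun x => (x, 0) ∈ B, univ.filter fun x => (x, 1) ∈ B, ?_⟩
  ext ⟨x, c⟩
  fin_cases c <;> simp [twoCopies]

/-- The pairs `(D, D')` of subsets `D ⊆ A` and `D' ⊆ A'` with `m` elements in total and at most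
`⌈m / 2⌉` in either set. They encode the possible sets `S ∩ (X ∪ Y)` for vertices `S` that have a
neighbour under the relation induced by `X = A × {1}` and `Y = A' × {2}`. -/
def balancedPairs (m : ℕ) (A A' : Finset (Fin n)) : Finset (Finset (Fin n) × Finset (Fin n)) :=
  {D ∈ A.powerset ×ˢ A'.powerset |
    #D.1 + #D.2 = m ∧ #D.1 ≤ (m + 1) / 2 ∧ #D.2 ≤ (m + 1) / 2}

theorem card_balancedPairs_le (m : ℕ) (A A' : Finset (Fin n)) :
    #(balancedPairs m A A') ≤ 2 ^ (#A + #A') := by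
  rw [pow_add, ← card_powerset, ← card_powerset, ← card_product]
  exact card_filter_le _ _

theorem KikuchiAdj.exists_balancedPairs {S T : Finset (Fin n × Fin 2)}
    (h : KikuchiAdj m A A' S T) : ∃ D ∈ balancedPairs m A A', twoCopies D.1 D.2 ⊆ S := by
  obtain ⟨-, heven, hodd⟩ := h
  obtain ⟨D, D', rfl⟩ := exists_eq_twoCopies S
  have inter_left : twoCopies D D' ∩ A ×ˢ {0} = (A ∩ D) ×ˢ {0} := by
    ext ⟨x, c⟩
    fin_cases c <;> simp [twoCopies, and_comm]
  have inter_right : twoCopies D D' ∩ A' ×ˢ {1} = (A' ∩ D') ×ˢ {1} := by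
    ext ⟨x, c⟩
    fin_cases c <;> simp [twoCopies, and_comm]
  simp only [inter_left, inter_right, card_product, card_singleton, mul_one] at heven hodd
  refine ⟨(A ∩ D, A' ∩ D'), mem_filter.2 ⟨?_, ?_⟩,
    twoCopies_subset_twoCopies.2 ⟨inter_subset_right, inter_subset_right⟩⟩
  · exact mem_product.2 ⟨mem_powerset.2 inter_subset_left, mem_powerset.2 inter_subset_left⟩
  · rcases Nat.even_or_odd' m with ⟨r, hr | hr⟩
    · have := heven ⟨r, by omega⟩
      dsimp only
      omega
    · have := hodd ⟨r, hr⟩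
      dsimp only
      omega

/-- Given `S` and the pair of hyperedges, the neighbour `T` is determined by the symmetric
difference. -/
theorem sum_kikuchiPairMatrix_le {ℓ : ℕ} (A A' : Finset (Fin n)) (S : KikuchiVertex n ℓ) :
    ∑ T, kikuchiPairMatrix m ℓ A A' S T
      ≤ #{D ∈ balancedPairs m A A' | twoCopies D.1 D.2 ⊆ S.1} := by
  classical
  simp only [kikuchiPairMatrix, sum_boole, Nat.cast_le]
  rcases Finset.eq_empty_or_nonempty {T : KikuchiVertex n ℓ | KikuchiAdj m A A' S.1 T.1}
    with hempty | ⟨T, hT⟩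
  · simp [hempty]
  obtain ⟨D, hD, hDS⟩ := (mem_filter.1 hT).2.exists_balancedPairs
  refine (card_le_one.2 fun T hT T' hT' => Subtype.ext ?_).trans
    (card_pos.2 ⟨D, mem_filter.2 ⟨hD, hDS⟩⟩)
  exact symmDiff_right_injective S.1 ((mem_filter.1 hT).2.1.trans (mem_filter.1 hT').2.1.symm)

end BalancedPairs

section Monomials

variable {n p q t m : ℕ} {E : Type} [Fintype E] {supp : E → Finset (Fin n)} {part : E → Fin p}
  {Q : Fin p → Finset (Fin n)} {M : Finset E}

/-- The linked pairs `(C, C')` together with a balanced pair `(D, D')` of subsets of `C \ Q_θ` and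
`C' \ Q_θ`. Such an index stands for the monomial `∏ x_v` over `v ∈ D × {1} ∪ D' × {2}` in the
indicator variables `x_v` of the event `v ∈ S`; the degree of `S` is at most the sum of these
monomials. -/
def kikuchiMonomials (m : ℕ) (supp : E → Finset (Fin n)) (part : E → Fin p)
    (Q : Fin p → Finset (Fin n)) (M : Finset E) :
    Finset ((_ : E × E) × Finset (Fin n) × Finset (Fin n)) :=
  (linkedPairs part M).sigma fun x =>
    balancedPairs m (linkEdge supp part Q x.1) (linkEdge supp part Q x.2)

theorem card_twoCopies_of_mem_kikuchiMonomials :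
    ∀ x ∈ kikuchiMonomials m supp part Q M, #(twoCopies x.2.1 x.2.2) = m := fun x hx => by
  rw [card_twoCopies]
  exact (mem_filter.1 (mem_sigma.1 hx).2).2.1

theorem card_kikuchiMonomials_above_le (hP : IsStrongRegularPartition q t supp part Q)
    (A A' : Finset (Fin n)) :
    #{x ∈ kikuchiMonomials m supp part Q M | A ⊆ x.2.1 ∧ A' ⊆ x.2.2}
      ≤ 4 ^ (q - t) * #(linkedPairsAbove supp part Q M A A') := by
  have fibre_le : ∀ x ∈ linkedPairsAbove supp part Q M A A',
      #(balancedPairs m (linkEdge supp part Q x.1) (linkEdge supp part Q x.2)) ≤ 4 ^ (q - t) := by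
    intro x _
    refine (card_balancedPairs_le _ _ _).trans_eq ?_
    rw [card_linkEdge hP, card_linkEdge hP, ← two_mul, pow_mul]
    norm_num
  rw [mul_comm]
  refine le_trans (card_le_card fun x hx => ?_)
    ((card_sigma _ _).trans_le (sum_le_card_nsmul _ _ _ fibre_le))
  obtain ⟨hx, hA, hA'⟩ := mem_filter.1 hx
  obtain ⟨hx_pair, hx_half⟩ := mem_sigma.1 hx
  obtain ⟨hD, hD'⟩ := mem_product.1 (mem_filter.1 hx_half).1
  exact mem_sigma.2 ⟨mem_filter.2 ⟨hx_pair, hA.trans (mem_powerset.1 hD),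
    hA'.trans (mem_powerset.1 hD')⟩, hx_half⟩

theorem isSpread_kikuchiMonomials (hq : Odd q) (hP : IsStrongRegularPartition q t supp part Q)
    (hM : (M : Set E).PairwiseDisjoint supp) :
    IsSpread (kikuchiMonomials (q - t) supp part Q M) (fun x => twoCopies x.2.1 x.2.2)
      (4 ^ (q - t) * (n * maxCodegree supp t)) ((n : ℝ) ^ (-(2 / (q : ℝ)))) := by
  intro B
  obtain ⟨A, A', rfl⟩ := exists_eq_twoCopies B
  simp only [twoCopies_subset_twoCopies]
  rcases Finset.eq_empty_or_nonempty
    {x ∈ kikuchiMonomials (q - t) supp part Q M | A ⊆ x.2.1 ∧ A' ⊆ x.2.2} with hempty | ⟨x, hx⟩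
  · rw [hempty, card_empty, Nat.cast_zero]
    positivity
  obtain ⟨hx, hA, hA'⟩ := mem_filter.1 hx
  obtain ⟨-, hcard, hD, hD'⟩ := mem_filter.1 (mem_sigma.1 hx).2
  have pairs_le := card_linkedPairsAbove_le_rpow (A := A) (A' := A') hq hP hM
    ((card_le_card hA).trans hD) ((card_le_card hA').trans hD')
    (hcard ▸ Nat.add_le_add (card_le_card hA) (card_le_card hA'))
  calc (#{x ∈ kikuchiMonomials (q - t) supp part Q M | A ⊆ x.2.1 ∧ A' ⊆ x.2.2} : ℝ)
      ≤ 4 ^ (q - t) * #(linkedPairsAbove supp part Q M A A') := by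
        exact_mod_cast card_kikuchiMonomials_above_le hP A A'
    _ ≤ 4 ^ (q - t) * (n * maxCodegree supp t * ((n : ℝ) ^ (-(2 / (q : ℝ)))) ^ (#A + #A')) := by
        gcongr
    _ = _ := by rw [card_twoCopies, mul_assoc (4 ^ (q - t))]

end Monomials

section Degree

variable {n k p m ℓ : ℕ} {H : Fin k → Finset (Finset (Fin n))}

theorem IsUniformMatching.pairwiseDisjoint_unionSupp {q : ℕ} {i : Fin k}
    (h : IsUniformMatching q (H i)) :
    (({e | e.1 = i} : Finset (UnionEdge H)) : Set (UnionEdge H)).PairwiseDisjoint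
      (unionSupp H) := by
  rintro ⟨j, C, hC⟩ he ⟨j', C', hC'⟩ he' hne
  simp only [coe_filter, mem_univ, true_and, Set.mem_ofPred_eq] at he he'
  subst he he'
  exact h.2 C hC C' hC' fun hCC' => hne (by subst hCC'; rfl)

theorem kikuchiUnsigned_apply (part : UnionEdge H → Fin p) (Q : Fin p → Finset (Fin n))
    (i j : Fin k) (S T : KikuchiVertex n ℓ) :
    kikuchiUnsigned m ℓ H part Q i j S T
      = ∑ x ∈ linkedPairs part {e | e.1 = i} with x.2.1 = j, kikuchiPairMatrix m ℓ
          (linkEdge (unionSupp H) part Q x.1) (linkEdge (unionSupp H) part Q x.2) S T := by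
  simp only [kikuchiUnsigned, Matrix.sum_apply]
  rw [← sum_fiberwise (filter _ (linkedPairs part _)) fun x => part x.1]
  refine sum_congr rfl fun θ _ => ?_
  rw [← sum_product']
  refine sum_congr ?_ fun x hx => ?_
  · ext x
    simp only [linkedPairs, mem_filter, mem_product, mem_univ, true_and]
    grind
  · obtain ⟨hx, hθ⟩ := mem_filter.1 hx
    rw [linkEdge, linkEdge, ← (mem_linkedPairs.1 (mem_filter.1 hx).1).2, hθ]

theorem kikuchiUnsigned_nonneg (part : UnionEdge H → Fin p) (Q : Fin p → Finset (Fin n))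
    (i j : Fin k) (S T : KikuchiVertex n ℓ) : 0 ≤ kikuchiUnsigned m ℓ H part Q i j S T := by
  rw [kikuchiUnsigned_apply]
  refine sum_nonneg fun x _ => ?_
  unfold kikuchiPairMatrix
  split_ifs <;> norm_num

theorem abs_kikuchiSigned_apply_le (part : UnionEdge H → Fin p) (Q : Fin p → Finset (Fin n))
    (R : Finset (Fin k)) (b : Fin k → ℤˣ) (i : Fin k) (S T : KikuchiVertex n ℓ) :
    |kikuchiSigned m ℓ H part Q R b i S T| ≤ ∑ j, kikuchiUnsigned m ℓ H part Q i j S T := by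
  have abs_term : ∀ j, |(((b j : ℤˣ) : ℤ) : ℝ) * kikuchiUnsigned m ℓ H part Q i j S T|
      = kikuchiUnsigned m ℓ H part Q i j S T := fun j => by
    rw [abs_mul, abs_of_nonneg (kikuchiUnsigned_nonneg part Q i j S T), ← Int.cast_abs,
      Int.isUnit_iff_abs_eq.1 (b j).isUnit, Int.cast_one, one_mul]
  simp only [kikuchiSigned, Matrix.sum_apply, Matrix.smul_apply, smul_eq_mul]
  calc _ ≤ ∑ j ∈ R, kikuchiUnsigned m ℓ H part Q i j S T :=
        (abs_sum_le_sum_abs _ _).trans_eq (sum_congr rfl fun j _ => abs_term j)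
    _ ≤ ∑ j, kikuchiUnsigned m ℓ H part Q i j S T :=
        sum_le_univ_sum_of_nonneg fun j => kikuchiUnsigned_nonneg part Q i j S T

theorem kikuchiDegree_le (part : UnionEdge H → Fin p) (Q : Fin p → Finset (Fin n))
    (R : Finset (Fin k)) (i : Fin k) (S : KikuchiVertex n ℓ) :
    kikuchiDegree m ℓ H part Q R i S
      ≤ #{x ∈ kikuchiMonomials m (unionSupp H) part Q {e | e.1 = i} |
          twoCopies x.2.1 x.2.2 ⊆ S.1} := by
  refine ciSup_le fun b => ?_
  calc ∑ T, |kikuchiSigned m ℓ H part Q R b i S T|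
      ≤ ∑ T, ∑ j, kikuchiUnsigned m ℓ H part Q i j S T :=
        sum_le_sum fun T _ => abs_kikuchiSigned_apply_le part Q R b i S T
    _ = ∑ x ∈ linkedPairs part {e | e.1 = i}, ∑ T, kikuchiPairMatrix m ℓ
          (linkEdge (unionSupp H) part Q x.1) (linkEdge (unionSupp H) part Q x.2) S T := by
        rw [sum_comm (s := linkedPairs part _)]
        simp only [kikuchiUnsigned_apply, sum_fiberwise]
    _ ≤ ∑ x ∈ linkedPairs part {e | e.1 = i},
          (#{D ∈ balancedPairs m (linkEdge (unionSupp H) part Q x.1)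
            (linkEdge (unionSupp H) part Q x.2) | twoCopies D.1 D.2 ⊆ S.1} : ℝ) :=
        sum_le_sum fun x _ => sum_kikuchiPairMatrix_le _ _ S
    _ = _ := by
        rw [← Nat.cast_sum, ← card_sigma]
        congr 2
        ext x
        simp only [kikuchiMonomials, mem_sigma, mem_filter, and_assoc]

end Degree

section Tail

theorem natCeil_log_natCast_le (n : ℕ) : (⌈Real.log n⌉₊ : ℝ) ≤ 2 * Real.log n := by
  rcases Nat.lt_or_ge n 2 with hn | hn
  · interval_cases n <;> simp
  · have log_two_le : Real.log 2 ≤ Real.log n :=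
      Real.log_le_log (by norm_num) (by exact_mod_cast hn)
    have half_lt_log : 2⁻¹ < Real.log n := by linarith [Real.log_two_gt_d9]
    exact Nat.ceil_le_two_mul half_lt_log.le

theorem exp_neg_mul_natCeil_log_le {b x : ℝ} (hb : 0 ≤ b) (hx : 0 < x) :
    Real.exp (-(b * ⌈Real.log x⌉₊)) ≤ x ^ (-b) := by
  rw [Real.rpow_def_of_pos hx, Real.exp_le_exp, mul_neg, mul_comm _ b, neg_le_neg_iff]
  gcongr
  exact Nat.le_ceil _

variable {n p q t ℓ : ℕ} {E : Type} [Fintype E] {supp : E → Finset (Fin n)} {part : E → Fin p}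
  {Q : Fin p → Finset (Fin n)} {M : Finset E}

theorem natCeil_log_mul_rpow_le (hn : 0 < n) (hℓ0 : 0 < ℓ)
    (hℓ : (n : ℝ) ^ (1 - 2 / (q : ℝ)) * Real.log n ≤ ℓ + 1) :
    ⌈Real.log n⌉₊ * (n : ℝ) ^ (-(2 / (q : ℝ))) ≤ 4 * (ℓ / n : ℝ) := by
  have hnR : (0 : ℝ) < n := by exact_mod_cast hn
  have hℓR : (1 : ℝ) ≤ ℓ := by exact_mod_cast hℓ0
  rw [← mul_div_assoc, le_div_iff₀ hnR]
  calc ⌈Real.log n⌉₊ * (n : ℝ) ^ (-(2 / (q : ℝ))) * n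
      ≤ 2 * Real.log n * (n : ℝ) ^ (-(2 / (q : ℝ))) * n := by
        gcongr
        exact natCeil_log_natCast_le n
    _ = 2 * ((n : ℝ) ^ (1 - 2 / (q : ℝ)) * Real.log n) := by
        rw [sub_eq_add_neg, Real.rpow_add hnR, Real.rpow_one]
        ring
    _ ≤ 4 * ℓ := by linarith

theorem card_filter_lt_kikuchiMonomials_le (hq : Odd q)
    (hP : IsStrongRegularPartition q t supp part Q) (hM : (M : Set E).PairwiseDisjoint supp)
    (hℓ : (n : ℝ) ^ (1 - 2 / (q : ℝ)) * Real.log n ≤ ℓ + 1) {b : ℝ} (hb : 0 ≤ b) :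
    (#{S : KikuchiVertex n ℓ |
        4 ^ (q - t) * (n * maxCodegree supp t) * (ℓ / n * Real.exp 4) ^ (q - t) * Real.exp b
          < #{x ∈ kikuchiMonomials (q - t) supp part Q M | twoCopies x.2.1 x.2.2 ⊆ S.1}} : ℝ)
      ≤ (n : ℝ) ^ (-b) * Fintype.card (KikuchiVertex n ℓ) := by
  have spread := isSpread_kikuchiMonomials hq hP hM
  by_cases hpos : 0 < n ∧ 0 < ℓ
  · obtain ⟨hn, hℓ0⟩ := hpos
    have hnR : (0 : ℝ) < n := by exact_mod_cast hn
    have density_le : (ℓ : ℝ) / Fintype.card (Fin n × Fin 2) ≤ ℓ / n := by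
      rw [Fintype.card_prod, Fintype.card_fin, Fintype.card_fin]
      gcongr
      omega
    refine (spread.card_filter_lt_le card_twoCopies_of_mem_kikuchiMonomials (by positivity)
      (by positivity) (by positivity) density_le (natCeil_log_mul_rpow_le hn hℓ0 hℓ) b).trans ?_
    rw [mul_comm]
    gcongr
    exact exp_neg_mul_natCeil_log_le hb hnR
  · have eq_empty : ∀ S : KikuchiVertex n ℓ, S.1 = ∅ := fun S => by
      have := S.2 ▸ card_le_univ S.1
      rw [Fintype.card_prod, Fintype.card_fin, Fintype.card_fin] at this
      exact card_eq_zero.1 (S.2.trans (by omega))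
    have density_eq : (ℓ : ℝ) / n = 0 := by
      rw [div_eq_zero_iff, Nat.cast_eq_zero, Nat.cast_eq_zero]
      omega
    rw [filter_eq_empty_iff.2 fun S _ => ?_, card_empty, Nat.cast_zero]
    · positivity
    · rw [eq_empty S, density_eq, zero_mul, not_lt]
      refine (spread.card_filter_subset_empty_le card_twoCopies_of_mem_kikuchiMonomials).trans ?_
      exact le_mul_of_one_le_right (by positivity) (Real.one_le_exp hb)

end Tail

open Classical in
theorem lemma4p10_general :
    ∃ W : ℝ, 1 ≤ W ∧
      ∀ (q t n k ℓ p : ℕ) (H : Fin k → Finset (Finset (Fin n)))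
        (part : UnionEdge H → Fin p) (Q : Fin p → Finset (Fin n)) (i : Fin k)
        (R : Finset (Fin k)),
        Odd q → IsUniformMatching q (H i) →
        IsStrongRegularPartition q t (unionSupp H) part Q →
        (n : ℝ) ^ (1 - 2 / (q : ℝ)) * Real.log n ≤ ℓ + 1 →
        (#{S : KikuchiVertex n ℓ | ¬ kikuchiDegree (q - t) ℓ H part Q R i S
            ≤ ((ℓ : ℝ) / n) ^ (q - t) * n * maxCodegree (unionSupp H) t * W ^ q} : ℝ)
          ≤ (n : ℝ) ^ (-(100 * (q : ℝ))) * Fintype.card (KikuchiVertex n ℓ) := by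
  have one_le : (1 : ℝ) ≤ 4 * Real.exp 4 := by linarith [Real.one_le_exp (x := 4) (by norm_num)]
  refine ⟨4 * Real.exp 4 * Real.exp 100, one_le_mul_of_one_le_of_one_le one_le
    (Real.one_le_exp (by norm_num)), fun q t n k ℓ p H part Q i R hq hH hP hℓ => ?_⟩
  refine le_trans ?_ (card_filter_lt_kikuchiMonomials_le hq hP hH.pairwiseDisjoint_unionSupp hℓ
    (b := 100 * q) (by positivity))
  refine Nat.cast_le.2 (card_le_card (monotone_filter_right _ fun S _ hS => ?_))
  refine lt_of_le_of_lt ?_ ((not_le.1 hS).trans_le (kikuchiDegree_le part Q R i S))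
  calc 4 ^ (q - t) * (n * maxCodegree (unionSupp H) t : ℝ) * (ℓ / n * Real.exp 4) ^ (q - t)
        * Real.exp (100 * q)
      = (ℓ / n : ℝ) ^ (q - t) * n * maxCodegree (unionSupp H) t
        * ((4 * Real.exp 4) ^ (q - t) * Real.exp 100 ^ q) := by
        rw [mul_comm (100 : ℝ), Real.exp_nat_mul, mul_pow, mul_pow]
        ring
    _ ≤ (ℓ / n : ℝ) ^ (q - t) * n * maxCodegree (unionSupp H) t
        * (4 * Real.exp 4 * Real.exp 100) ^ q := by
        rw [mul_pow _ (Real.exp 100)]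
        gcongr
        omega

open Classical in
theorem lemma4p10 :
    ∃ W : ℝ, 1 ≤ W ∧
      ∀ (q t n k ℓ p : ℕ) (H : Fin k → Finset (Finset (Fin n)))
        (part : UnionEdge H → Fin p) (Q : Fin p → Finset (Fin n)),
        3 ≤ q → Odd q →
        (∀ i, IsUniformMatching q (H i)) →
        IsStrongRegularPartition q t (unionSupp H) part Q →
        -- `ℓ` is `n ^ (1 - 2 / q) * log n`, rounded up or down to an integer
        |(ℓ : ℝ) - (n : ℝ) ^ (1 - 2 / (q : ℝ)) * Real.log n| < 1 →
        maxCodegree (unionSupp H) 1 ≤ k →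
        ℓ ≤ maxCodegree (unionSupp H) 1 →
        (2 * t < q →
          (maxCodegree (unionSupp H) 1 : ℝ) * (n : ℝ) ^ (-(2 * ((t : ℝ) - 1) / q))
            ≤ maxCodegree (unionSupp H) t) ∧
        (q < 2 * t →
          (maxCodegree (unionSupp H) 1 : ℝ) * (n : ℝ) ^ (-1 + 2 / (q : ℝ))
            ≤ maxCodegree (unionSupp H) t) ∧
        ∀ L R : Finset (Fin k), Disjoint L R → L ∪ R = Finset.univ → ∀ i ∈ L,
          ((Finset.univ.filter fun S : KikuchiVertex n ℓ =>
              ¬ kikuchiDegree (q - t) ℓ H part Q R i S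
                ≤ ((ℓ : ℝ) / n) ^ (q - t) * n * maxCodegree (unionSupp H) t * W ^ q).card : ℝ)
            ≤ (n : ℝ) ^ (-(100 * (q : ℝ))) * Fintype.card (KikuchiVertex n ℓ) := by
  obtain ⟨W, hW, degree_bound⟩ := lemma4p10_general
  refine ⟨W, hW, fun q t n k ℓ p H part Q _ hq hH hP hℓ _ _ =>
    ⟨fun htq => ?_, hP.good.lower_right, fun L R _ _ i _ => ?_⟩⟩
  · rw [mul_div_right_comm, ← neg_mul]
    exact hP.good.lower_left htq
  · exact degree_bound q t n k ℓ p H part Q i R hq (hH i) hP (by linarith [abs_lt.1 hℓ])
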